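/- Call $F:\mathbb R\to[0,1]$ a distribution function if $F(t)=\mu((-\infty,t])$ for a probability measure $\mu$ on $\mathbb R$, and write $\bar F=1-F$. For distribution functions $F,G$ let $F\boxdot G=\max(F+G-1,0)$, and for $n\ge 1$ let $F^{\boxdot n}=F\boxdot\cdots\boxdot F$ ($n$ factors), so that $F^{\boxdot n}=\max(nF-(n-1),0)$. We say that $F$ is in the free (respectively classical) max-domain of attraction of a distribution function $G$ if there are real numbers $a_n>0$ and $b_n$ such that, as $n\to\infty$, $F^{\boxdot n}(a_nx+b_n)\to G(x)$ (respectively $F(a_nx+b_n)^n\to G(x)$) at every continuity point $x$ of $G$. For $\alpha>0$ let $P_\alpha$ be the Pareto distribution function with exponent $\alpha$, $P_\alpha(x)=\max(1-x^{-\alpha},0)$ for $x>0$ and $P_\alpha(x)=0$ for $x\le 0$, and let $\Phi_\alpha$ be the Fréchet distribution function, $\Phi_\alpha(x)=\exp(-x^{-\alpha})$ for $x>0$ and $\Phi_\alpha(x)=0$ for $x\le 0$. **Theorem.** Let $\alpha>0$ and let $F$ be a distribution function on $\mathbb R$. The following are equivalent: (i) $F$ is in the free max-domain of attraction of $P_\alpha$;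 (ii) $F$ is in the classical max-domain of attraction of $\Phi_\alpha$; (iii) $\bar F$ is regularly varying at $\infty$ with index $-\alpha$, that is, $\bar F(t)>0$ for all large $t$ and $\lim_{t\to\infty}\bar F(tx)/\bar F(t)=x^{-\alpha}$ for every $x>0$. Moreover, when these conditions hold, the normalizing constants in both (i) and (ii) can be taken to be $a_n=u_n$ and $b_n=0$, where $u_n=\inf\{t\in\mathbb R:\bar F(t)<1/n\}$: one has $u_n>0$ for all sufficiently large $n$, and, as $n\to\infty$, $F^{\boxdot n}(u_nx)\to P_\alpha(x)$ at every continuity point $x$ of $P_\alpha$ and $F(u_nx)^n\to\Phi_\alpha(x)$ at every continuity point $x$ of $\Phi_\alpha$. -/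

import Mathlib

open Filter Topology MeasureTheory

noncomputable section

/-- `F` is the distribution function `t ↦ μ((-∞, t])` of a probability measure `μ` on `ℝ`. -/
def IsDistributionFunction (F : ℝ → ℝ) : Prop :=
  ∃ μ : Measure ℝ, IsProbabilityMeasure μ ∧ ∀ t, F t = μ.real (Set.Iic t)

/-- The tail `1 - F`. -/
def tail (F : ℝ → ℝ) : ℝ → ℝ := fun x => 1 - F x

/-- The (upper) extremal free convolution `(F + G - 1)₊` of two distribution functions. -/
def freeMaxConv (F G : ℝ → ℝ) : ℝ → ℝ := fun x => max (F x + G x - 1) 0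

/-- The `n`-fold iterate of the extremal free convolution of `F` with itself. The value at `n = 0`
is the neutral element of the convolution, the constant `1`. -/
def freeMaxPow (F : ℝ → ℝ) : ℕ → ℝ → ℝ
  | 0 => fun _ => 1
  | n + 1 => freeMaxConv (freeMaxPow F n) F

/-- Weak convergence of distribution functions: convergence at every continuity point of the
limit `G`. -/
def WeakConv (H : ℕ → ℝ → ℝ) (G : ℝ → ℝ) : Prop :=
  ∀ x, ContinuousAt G x → Tendsto (fun n => H n x) atTop (𝓝 (G x))

/-- `F` is in the free max-domain of attraction of `G`. -/
def InFreeMaxDomain (F G : ℝ → ℝ) : Prop :=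
  ∃ a b : ℕ → ℝ, (∀ n, 0 < a n) ∧ WeakConv (fun n x => freeMaxPow F n (a n * x + b n)) G

/-- `F` is in the classical max-domain of attraction of `G`; `F ^ n` is the distribution function
of the maximum of `n` independent variables with distribution function `F`. -/
def InClassicalMaxDomain (F G : ℝ → ℝ) : Prop :=
  ∃ a b : ℕ → ℝ, (∀ n, 0 < a n) ∧ WeakConv (fun n x => F (a n * x + b n) ^ n) G

/-- The Pareto distribution function with exponent `α`: `(1 - x ^ (-α))₊`, concentrated on
`[1, ∞)`. -/
def paretoDF (α : ℝ) : ℝ → ℝ := fun x => if 0 < x then max (1 - x ^ (-α)) 0 else 0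

/-- The Fréchet distribution function `Φ_α`. -/
def frechetDF (α : ℝ) : ℝ → ℝ := fun x => if 0 < x then Real.exp (-x ^ (-α)) else 0

/-- `f` is regularly varying at `∞` with index `ρ`. -/
def RegularlyVaryingAtTop (f : ℝ → ℝ) (ρ : ℝ) : Prop :=
  Measurable f ∧ (∀ᶠ t in atTop, 0 < f t) ∧
    ∀ x, 0 < x → Tendsto (fun t => f (t * x) / f t) atTop (𝓝 (x ^ ρ))

/-- `u_n = inf {t | 1 - F t < 1 / n}`. For `n ≥ 2` and `F` a distribution function, the set is
nonempty and bounded below; the values at `n = 0` and `n = 1` play no role in limits. -/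
def tailQuantile (F : ℝ → ℝ) (n : ℕ) : ℝ := sInf {t : ℝ | tail F t < 1 / (n : ℝ)}

end

/-!
Write `T = 1 - F`. The free convolution power is `max (1 - n * T) 0`, and `F ^ n` converges to
`exp (-c)` if and only if `n * T` converges to `c`. Hence each of the two domain conditions yields
`n * T (a n * x + b n) → x ^ (-α)` for every `x > 1` (`HasParetoTailLimit`), and this common
consequence alone implies regular variation of `T`.

The first task is to remove the shifts `b n`. Since the limit is strictly decreasing and `T` is
monotone, the argument of `T` can be recovered asymptotically from its value
(`HasParetoTailLimit.tendsto_div`). Comparing the norming with index `n` to that with index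
`m = ⌊n / 2⌋` gives `a n / a m → 2 ^ (1 / α)` and `(b n - b m) / a m → 0`, as in the theorem on
convergence of types. Both `b n / a n` and `1 / a n` thus satisfy a perturbed contracting recurrence
along the halving map, and they tend to `0` (`tendsto_zero_of_halving_recurrence`). So the shifts
may be dropped, and the right endpoint of `F` is infinite. Regular variation along the continuous
parameter `t` follows by taking `n` close to a multiple of `1 / T t`
(`HasParetoTailLimit.tendsto_ratio`).

Conversely, let `T` be regularly varying and let `u n` be the tail quantile. For `y < 1 < z` one has
`T (u n * z) < 1 / n ≤ T (u n * y)` for large `n`, and by regular variation these tails have ratios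
to `T (u n)` whose limits are close to `1` when `y` and `z` are. Therefore `n * T (u n) → 1`, so
`n * T (u n * x) → x ^ (-α)` for `x > 0`
(`RegularlyVaryingAtTop.tendsto_mul_tail`), and both domain conditions hold with norming `u n` and
no shift; for `x ≤ 0` the limits come from monotonicity.
-/

/-! ### Distribution functions and the free convolution power -/

namespace IsDistributionFunction

variable {F : ℝ → ℝ}

theorem nonneg (hF : IsDistributionFunction F) (t : ℝ) : 0 ≤ F t := by
  obtain ⟨μ, hμ, h⟩ := hF
  rw [h]
  exact measureReal_nonneg

theorem tail_nonneg (hF : IsDistributionFunction F) (t : ℝ) : 0 ≤ tail F t := by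
  obtain ⟨μ, hμ, h⟩ := hF
  simp only [tail, h, sub_nonneg]
  exact measureReal_le_one

theorem monotone (hF : IsDistributionFunction F) : Monotone F := by
  obtain ⟨μ, hμ, h⟩ := hF
  intro s t hst
  rw [h, h]
  exact measureReal_mono (Set.Iic_subset_Iic.2 hst)

theorem antitone_tail (hF : IsDistributionFunction F) : Antitone (tail F) := fun _ _ hst =>
  sub_le_sub_left (hF.monotone hst) 1

theorem tendsto_tail_atTop (hF : IsDistributionFunction F) :
    Tendsto (tail F) atTop (𝓝 0) := by
  obtain ⟨μ, hμ, h⟩ := hF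
  have h1 : F = ProbabilityTheory.cdf μ := by
    ext t
    rw [h, ProbabilityTheory.cdf_eq_real]
  have h2 := (ProbabilityTheory.tendsto_cdf_atTop μ).const_sub 1
  rw [← h1, sub_self] at h2
  exact h2

theorem freeMaxPow_eq (hF : IsDistributionFunction F) (n : ℕ) (x : ℝ) :
    freeMaxPow F n x = max (1 - n * tail F x) 0 := by
  induction n with
  | zero => simp [freeMaxPow]
  | succ n ih =>
    have h := hF.tail_nonneg x
    have hF' : F x = 1 - tail F x := by simp [tail]
    simp only [freeMaxPow, freeMaxConv, ih]
    rw [hF']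
    push_cast
    rcases le_total (1 - n * tail F x) 0 with h1 | h1
    · rw [max_eq_right h1, max_eq_right (by linarith), max_eq_right (by linarith)]
    · rw [max_eq_left h1]
      ring_nf

end IsDistributionFunction

/-! ### Sequences contracting along the halving map -/

theorem tendsto_natDiv_two_atTop : Tendsto (fun n : ℕ => n / 2) atTop atTop :=
  Nat.tendsto_div_const_atTop two_ne_zero

theorem tendsto_natDiv_two_div_self :
    Tendsto (fun n : ℕ => ((n / 2 : ℕ) : ℝ) / n) atTop (𝓝 (1 / 2)) := by
  have h0 : Tendsto (fun n : ℕ => (1 / 2 : ℝ) - 1 / n) atTop (𝓝 (1 / 2)) := by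
    have h := (tendsto_const_div_atTop_nhds_zero_nat (1 : ℝ)).const_sub (1 / 2)
    rwa [sub_zero] at h
  refine tendsto_of_tendsto_of_tendsto_of_le_of_le' h0 tendsto_const_nhds ?_ ?_
  · filter_upwards [eventually_gt_atTop 0] with n hn
    have hn' : (0 : ℝ) < n := by exact_mod_cast hn
    have h : (n : ℝ) ≤ 2 * ((n / 2 : ℕ) : ℝ) + 1 := by
      have : n ≤ 2 * (n / 2) + 1 := by omega
      exact_mod_cast this
    rw [le_div_iff₀ hn', sub_mul, div_mul_cancel₀ _ hn'.ne']
    linarith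
  · filter_upwards [eventually_gt_atTop 0] with n hn
    have hn' : (0 : ℝ) < n := by exact_mod_cast hn
    have h : 2 * ((n / 2 : ℕ) : ℝ) ≤ n := by
      have : 2 * (n / 2) ≤ n := by omega
      exact_mod_cast this
    rw [div_le_iff₀ hn']
    linarith

/-- A perturbed linear contraction that links the `n`-th term to the `⌊n / 2⌋`-th term drives the
sequence to `0`. -/
theorem tendsto_zero_of_halving_recurrence {r θ η : ℕ → ℝ} {q : ℝ} (hq1 : |q| < 1)
    (hθ : Tendsto θ atTop (𝓝 q)) (hη : Tendsto η atTop (𝓝 0))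
    (hr : ∀ᶠ n in atTop, r n = θ n * r (n / 2) + η n) : Tendsto r atTop (𝓝 0) := by
  obtain ⟨ρ, hqρ, hρ1⟩ := exists_between hq1
  have hρ0 : 0 < ρ := (abs_nonneg q).trans_lt hqρ
  have hstep : ∀ ε > 0, ∀ᶠ n in atTop, |r n| ≤ ρ * |r (n / 2)| + ε := by
    intro ε hε
    have hη' : Tendsto (fun n => |η n|) atTop (𝓝 0) := by simpa using hη.abs
    filter_upwards [hr, hθ.abs.eventually (gt_mem_nhds hqρ), hη'.eventually (gt_mem_nhds hε)]
      with n h1 h2 h3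
    calc |r n| ≤ |θ n| * |r (n / 2)| + |η n| := by
          rw [h1, ← abs_mul]
          exact abs_add_le _ _
      _ ≤ ρ * |r (n / 2)| + ε := by gcongr
  obtain ⟨C, hC⟩ : ∃ C, ∀ n, |r n| ≤ C := by
    obtain ⟨N, hN⟩ := eventually_atTop.1 (hstep 1 one_pos)
    set C := max (∑ i ∈ Finset.range (N + 1), |r i|) (1 / (1 - ρ))
    refine ⟨C, fun n => ?_⟩
    induction n using Nat.strong_induction_on with
    | _ n ih =>
      rcases lt_or_ge n (N + 1) with h | h
      · exact (Finset.single_le_sum (f := fun i => |r i|) (fun i _ => abs_nonneg _)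
          (Finset.mem_range.2 h)).trans (le_max_left _ _)
      · have h1 := hN n (by omega)
        have h2 := ih (n / 2) (by omega)
        have h3 : 1 ≤ C * (1 - ρ) := (div_le_iff₀ (by linarith)).1 (le_max_right _ _)
        nlinarith
  have hiter : ∀ ε > 0, ∀ k : ℕ, ∀ᶠ n in atTop, |r n| ≤ ρ ^ k * C + ε := by
    intro ε hε k
    induction k with
    | zero =>
      filter_upwards with n
      linarith [hC n]
    | succ k ih =>
      filter_upwards [hstep (ε * (1 - ρ)) (mul_pos hε (by linarith)),
        tendsto_natDiv_two_atTop.eventually ih] with n h1 h2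
      calc |r n| ≤ ρ * |r (n / 2)| + ε * (1 - ρ) := h1
        _ ≤ ρ * (ρ ^ k * C + ε) + ε * (1 - ρ) := by gcongr
        _ = ρ ^ (k + 1) * C + ε := by ring
  rw [tendsto_zero_iff_abs_tendsto_zero]
  refine tendsto_order.2 ⟨fun c hc => .of_forall fun n => hc.trans_le (abs_nonneg _),
    fun c hc => ?_⟩
  have hpow : Tendsto (fun k : ℕ => ρ ^ k * C) atTop (𝓝 0) := by
    simpa using (tendsto_pow_atTop_nhds_zero_of_lt_one hρ0.le hρ1).mul_const C
  obtain ⟨k, hk⟩ := (hpow.eventually (gt_mem_nhds (half_pos hc))).exists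
  filter_upwards [hiter (c / 2) (half_pos hc) k] with n hn
  exact hn.trans_lt (by linarith)

/-! ### Pareto limits of a nonincreasing function -/

/-- The rescaled values `n * T (a n * x + b n)` converge to the Pareto tail `x ^ (-α)`, for `x` in
the half-line `(1, ∞)` only: this is what the free and the classical limit have in common. -/
def HasParetoTailLimit (α : ℝ) (T : ℝ → ℝ) (a b : ℕ → ℝ) : Prop :=
  ∀ x, 1 < x → Tendsto (fun n : ℕ => n * T (a n * x + b n)) atTop (𝓝 (x ^ (-α)))

theorem rpow_neg_lt_rpow_neg {α x y : ℝ} (hα : 0 < α) (hx : 0 < x) (hxy : x < y) :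
    y ^ (-α) < x ^ (-α) :=
  Real.rpow_lt_rpow_of_neg hx hxy (neg_lt_zero.2 hα)

namespace HasParetoTailLimit

variable {α : ℝ} {T : ℝ → ℝ} {a b : ℕ → ℝ} {ι : Type*} {l : Filter ι} {n : ι → ℕ} {y : ι → ℝ}
  {x : ℝ}

/-- The limit extends from points `a n * x + b n` to points asymptotic to them, because `T` is
monotone and the limit is continuous. -/
theorem tendsto_mul (hC : HasParetoTailLimit α T a b) (hT : Antitone T)
    (ha : ∀ n, 0 < a n) (hn : Tendsto n l atTop) (hx : 1 < x)
    (hy : Tendsto (fun i => (y i - b (n i)) / a (n i)) l (𝓝 x)) :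
    Tendsto (fun i => (n i : ℝ) * T (y i)) l (𝓝 (x ^ (-α))) := by
  have hcont : Tendsto (fun z : ℝ => z ^ (-α)) (𝓝 x) (𝓝 (x ^ (-α))) :=
    Real.continuousAt_rpow_const _ _ (Or.inl (by positivity))
  refine tendsto_order.2 ⟨fun c hc => ?_, fun c hc => ?_⟩
  · obtain ⟨z, hz, hxz⟩ := (((hcont.mono_left nhdsWithin_le_nhds).eventually
      (lt_mem_nhds hc)).and (self_mem_nhdsWithin (s := Set.Ioi x))).exists
    filter_upwards [hy.eventually (gt_mem_nhds hxz),
      hn.eventually ((hC z (hx.trans hxz)).eventually (lt_mem_nhds hz))] with i h1 h2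
    refine h2.trans_le (mul_le_mul_of_nonneg_left (hT ?_) (Nat.cast_nonneg _))
    rw [div_lt_iff₀ (ha _)] at h1
    linarith
  · obtain ⟨z, hz, hz1, hzx⟩ := (((hcont.mono_left nhdsWithin_le_nhds).eventually
      (gt_mem_nhds hc)).and (Ioo_mem_nhdsLT hx)).exists
    filter_upwards [hy.eventually (lt_mem_nhds hzx),
      hn.eventually ((hC z hz1).eventually (gt_mem_nhds hz))] with i h1 h2
    refine (mul_le_mul_of_nonneg_left (hT ?_) (Nat.cast_nonneg _)).trans_lt h2
    rw [lt_div_iff₀ (ha _)] at h1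
    linarith

/-- Converse of `tendsto_mul`: the value of `T` locates the argument, because the limit is
strictly decreasing. -/
theorem tendsto_div (hC : HasParetoTailLimit α T a b) (hα : 0 < α) (hT : Antitone T)
    (ha : ∀ n, 0 < a n) (hn : Tendsto n l atTop) (hx : 1 < x)
    (hy : Tendsto (fun i => (n i : ℝ) * T (y i)) l (𝓝 (x ^ (-α)))) :
    Tendsto (fun i => (y i - b (n i)) / a (n i)) l (𝓝 x) := by
  refine tendsto_order.2 ⟨fun c hc => ?_, fun c hc => ?_⟩
  · obtain ⟨z, hz, hzx⟩ := exists_between (max_lt hc hx)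
    obtain ⟨hcz, hz1⟩ := max_lt_iff.1 hz
    have hlt := rpow_neg_lt_rpow_neg hα (one_pos.trans hz1) hzx
    filter_upwards [hy.eventually_lt ((hC z hz1).comp hn) hlt] with i h1
    have h2 : T (y i) < T (a (n i) * z + b (n i)) :=
      lt_of_mul_lt_mul_left h1 (Nat.cast_nonneg _)
    have h3 := hT.reflect_lt h2
    refine hcz.trans ?_
    rw [lt_div_iff₀ (ha _)]
    linarith
  · have hlt := rpow_neg_lt_rpow_neg hα (one_pos.trans hx) hc
    filter_upwards [((hC c (hx.trans hc)).comp hn).eventually_lt hy hlt] with i h1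
    have h2 : T (a (n i) * c + b (n i)) < T (y i) :=
      lt_of_mul_lt_mul_left h1 (Nat.cast_nonneg _)
    have h3 := hT.reflect_lt h2
    rw [div_lt_iff₀ (ha _)]
    linarith

/-- The affine maps with index `n` and `⌊n / 2⌋` differ asymptotically by the dilation with ratio
`2 ^ (1 / α)`. -/
theorem tendsto_halving (hC : HasParetoTailLimit α T a b) (hα : 0 < α) (hT : Antitone T)
    (ha : ∀ n, 0 < a n) (hx : 1 < x) :
    Tendsto (fun n => (a n * x + b n - b (n / 2)) / a (n / 2)) atTop
      (𝓝 (2 ^ (1 / α) * x)) := by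
  have hq : (1 : ℝ) < 2 ^ (1 / α) := Real.one_lt_rpow one_lt_two (by positivity)
  refine hC.tendsto_div hα hT ha tendsto_natDiv_two_atTop (one_lt_mul_of_lt_of_le hq hx.le) ?_
  have hval : (2 ^ (1 / α) * x) ^ (-α) = 1 / 2 * x ^ (-α) := by
    rw [Real.mul_rpow (by positivity) (by positivity), ← Real.rpow_mul (by norm_num),
      show 1 / α * -α = -1 by field_simp, Real.rpow_neg_one, one_div]
  rw [hval]
  refine (tendsto_natDiv_two_div_self.mul (hC x hx)).congr' ?_
  filter_upwards [eventually_ne_atTop 0] with n hn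
  have hn' : (n : ℝ) ≠ 0 := Nat.cast_ne_zero.2 hn
  field_simp

theorem tendsto_scale_halving (hC : HasParetoTailLimit α T a b) (hα : 0 < α) (hT : Antitone T)
    (ha : ∀ n, 0 < a n) :
    Tendsto (fun n => a (n / 2) / a n) atTop (𝓝 (2 ^ (1 / α))⁻¹) := by
  have h := (hC.tendsto_halving hα hT ha (x := 3) (by norm_num)).sub
    (hC.tendsto_halving hα hT ha (x := 2) (by norm_num))
  rw [show (2 : ℝ) ^ (1 / α) * 3 - 2 ^ (1 / α) * 2 = 2 ^ (1 / α) by ring] at h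
  refine (h.inv₀ (by positivity)).congr fun n => ?_
  rw [← sub_div, inv_div]
  ring_nf

theorem tendsto_shift_halving (hC : HasParetoTailLimit α T a b) (hα : 0 < α) (hT : Antitone T)
    (ha : ∀ n, 0 < a n) :
    Tendsto (fun n => (b n - b (n / 2)) / a (n / 2)) atTop (𝓝 0) := by
  have h := ((hC.tendsto_halving hα hT ha (x := 2) (by norm_num)).const_mul 3).sub
    ((hC.tendsto_halving hα hT ha (x := 3) (by norm_num)).const_mul 2)
  rw [show 3 * ((2 : ℝ) ^ (1 / α) * 2) - 2 * (2 ^ (1 / α) * 3) = 0 by ring] at h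
  refine h.congr fun n => ?_
  ring

theorem abs_inv_ratio_lt_one (hα : 0 < α) : |((2 : ℝ) ^ (1 / α))⁻¹| < 1 := by
  rw [abs_of_nonneg (by positivity)]
  exact inv_lt_one_of_one_lt₀ (Real.one_lt_rpow one_lt_two (by positivity))

/-- The shifts satisfy `b n / a n = θ n * (b (n / 2) / a (n / 2)) + o(1)` with
`θ n = a (n / 2) / a n` tending to `2 ^ (-1 / α) < 1`. -/
theorem tendsto_shift_div_scale (hC : HasParetoTailLimit α T a b) (hα : 0 < α) (hT : Antitone T)
    (ha : ∀ n, 0 < a n) : Tendsto (fun n => b n / a n) atTop (𝓝 0) := by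
  have hs := hC.tendsto_scale_halving hα hT ha
  have hb := (hC.tendsto_shift_halving hα hT ha).mul hs
  rw [zero_mul] at hb
  refine tendsto_zero_of_halving_recurrence (abs_inv_ratio_lt_one hα) hs hb (.of_forall fun n => ?_)
  have h1 := (ha n).ne'
  have h2 := (ha (n / 2)).ne'
  field_simp
  ring

theorem tendsto_scale_atTop (hC : HasParetoTailLimit α T a b) (hα : 0 < α) (hT : Antitone T)
    (ha : ∀ n, 0 < a n) : Tendsto a atTop atTop := by
  have h : Tendsto (fun n => (a n)⁻¹) atTop (𝓝 0) := by
    refine tendsto_zero_of_halving_recurrence (abs_inv_ratio_lt_one hα)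
      (hC.tendsto_scale_halving hα hT ha) tendsto_const_nhds (.of_forall fun n => ?_)
    have h1 := (ha n).ne'
    have h2 := (ha (n / 2)).ne'
    field_simp
    ring
  have h' : Tendsto (fun n => (a n)⁻¹) atTop (𝓝[>] 0) :=
    tendsto_nhdsWithin_iff.2 ⟨h, .of_forall fun n => inv_pos.2 (ha n)⟩
  exact h'.inv_tendsto_nhdsGT_zero.congr fun n => inv_inv (a n)

/-- The points `a n * x` and `a n * x + b n` are asymptotic, so the shifts may be dropped. -/
theorem without_shift (hC : HasParetoTailLimit α T a b) (hα : 0 < α) (hT : Antitone T)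
    (ha : ∀ n, 0 < a n) : HasParetoTailLimit α T a 0 := by
  intro x hx
  simp only [Pi.zero_apply, add_zero]
  refine hC.tendsto_mul hT ha tendsto_id hx ?_
  have h := (hC.tendsto_shift_div_scale hα hT ha).const_sub x
  rw [sub_zero] at h
  refine h.congr fun n => ?_
  have h1 := (ha n).ne'
  field_simp

/-- Since the scales tend to infinity, `T` is positive at arbitrarily large arguments. -/
theorem pos (hC : HasParetoTailLimit α T a b) (hα : 0 < α) (hT : Antitone T)
    (ha : ∀ n, 0 < a n) (t : ℝ) : 0 < T t := by
  have h := (hC.without_shift hα hT ha 2 one_lt_two).eventually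
    (lt_mem_nhds (Real.rpow_pos_of_pos two_pos (-α)))
  obtain ⟨n, h1, h2⟩ := (h.and ((hC.tendsto_scale_atTop hα hT ha).eventually_ge_atTop |t|)).exists
  simp only [Pi.zero_apply, add_zero] at h1
  have h3 : 0 < T (a n * 2) := pos_of_mul_pos_right h1 (Nat.cast_nonneg _)
  exact h3.trans_le (hT (by linarith [le_abs_self t, ha n]))

/-- Regular variation of `T`: with `n = n(t)` chosen such that `n * T t` converges to `y ^ (-α)`,
the point `t` is asymptotic to `a n * y`, so that `n * T (t * x)` converges to
`(y * x) ^ (-α)`. -/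
theorem tendsto_ratio (hC : HasParetoTailLimit α T a b) (hα : 0 < α) (hT : Antitone T)
    (ha : ∀ n, 0 < a n) (hT0 : Tendsto T atTop (𝓝 0)) (hx : 0 < x) :
    Tendsto (fun t => T (t * x) / T t) atTop (𝓝 (x ^ (-α))) := by
  have hpos := hC.pos hα hT ha
  have hC' := hC.without_shift hα hT ha
  -- Both `y` and `y * x` have to exceed `1`, where the limit is known.
  obtain ⟨y, hy1, hyx⟩ : ∃ y : ℝ, 1 < y ∧ 1 < y * x := by
    refine ⟨max 2 (2 / x), by simp, ?_⟩
    have := mul_le_mul_of_nonneg_right (le_max_right 2 (2 / x)) hx.le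
    rw [div_mul_cancel₀ _ hx.ne'] at this
    linarith
  have hy0 : 0 < y := one_pos.trans hy1
  have hc : 0 < y ^ (-α) := Real.rpow_pos_of_pos hy0 _
  -- The index `⌊y ^ (-α) / T t⌋` is the one for which `t` lies near `a n * y`.
  have hinv : Tendsto (fun t => (T t)⁻¹) atTop atTop :=
    Tendsto.inv_tendsto_nhdsGT_zero (tendsto_nhdsWithin_iff.2 ⟨hT0, .of_forall hpos⟩)
  have hdiv : Tendsto (fun t => y ^ (-α) * (T t)⁻¹) atTop atTop := hinv.const_mul_atTop hc
  set n : ℝ → ℕ := fun t => ⌊y ^ (-α) * (T t)⁻¹⌋₊ with hndef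
  have hn : Tendsto n atTop atTop := tendsto_nat_floor_atTop.comp hdiv
  have hnT : Tendsto (fun t => (n t : ℝ) * T t) atTop (𝓝 (y ^ (-α))) := by
    have h := (((tendsto_nat_floor_div_atTop (R := ℝ)).comp hdiv)).mul_const (y ^ (-α))
    rw [one_mul] at h
    refine h.congr fun t => ?_
    have h1 := (hpos t).ne'
    simp only [Function.comp, hndef]
    field_simp
  have hta := hC'.tendsto_div hα hT ha hn hy1 hnT
  have htxa : Tendsto (fun t => (t * x - (0 : ℕ → ℝ) (n t)) / a (n t)) atTop (𝓝 (y * x)) := by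
    refine (hta.mul_const x).congr fun t => ?_
    simp only [Pi.zero_apply, sub_zero]
    ring
  have hnTx := hC'.tendsto_mul hT ha hn hyx htxa
  have hratio := hnTx.div hnT hc.ne'
  rw [Real.mul_rpow hy0.le hx.le, mul_div_cancel_left₀ _ hc.ne'] at hratio
  refine hratio.congr' ?_
  filter_upwards [hn.eventually_ne_atTop 0] with t ht
  exact mul_div_mul_left _ _ (Nat.cast_ne_zero.2 ht)

end HasParetoTailLimit

/-! ### From max-domains of attraction to regular variation -/

theorem HasParetoTailLimit.regularlyVaryingAtTop_tail {α : ℝ} (hα : 0 < α) {F : ℝ → ℝ}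
    (hF : IsDistributionFunction F) {a b : ℕ → ℝ}
    (hC : HasParetoTailLimit α (tail F) a b) (ha : ∀ n, 0 < a n) : RegularlyVaryingAtTop (tail F) (-α) :=
  ⟨hF.antitone_tail.measurable,
    .of_forall (hC.pos hα hF.antitone_tail ha),
    fun _ hx => hC.tendsto_ratio hα hF.antitone_tail ha hF.tendsto_tail_atTop hx⟩

theorem InFreeMaxDomain.regularlyVaryingAtTop_tail {α : ℝ} (hα : 0 < α) {F : ℝ → ℝ}
    (hF : IsDistributionFunction F) (h : InFreeMaxDomain F (paretoDF α)) :
    RegularlyVaryingAtTop (tail F) (-α) := by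
  obtain ⟨a, b, ha, hw⟩ := h
  refine HasParetoTailLimit.regularlyVaryingAtTop_tail hα hF (b := b) (fun x hx => ?_) ha
  have hx0 : 0 < x := one_pos.trans hx
  have hlt : x ^ (-α) < 1 := Real.rpow_lt_one_of_one_lt_of_neg hx (neg_lt_zero.2 hα)
  have hcont : ContinuousAt (paretoDF α) x := by
    have h1 : ContinuousAt (fun z : ℝ => max (1 - z ^ (-α)) 0) x :=
      (continuousAt_const.sub (Real.continuousAt_rpow_const _ _ (Or.inl hx0.ne'))).max
        continuousAt_const
    refine h1.congr ?_
    filter_upwards [lt_mem_nhds hx0] with z hz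
    simp [paretoDF, hz]
  have hlim := hw x hcont
  simp only [paretoDF, hx0, if_true, hF.freeMaxPow_eq] at hlim
  rw [max_eq_left (by linarith)] at hlim
  have h2 := hlim.const_sub 1
  rw [sub_sub_cancel] at h2
  refine h2.congr' ?_
  filter_upwards [hlim.eventually (lt_mem_nhds (sub_pos.2 hlt))] with n hn
  rcases lt_max_iff.1 hn with h3 | h3
  · rw [max_eq_left h3.le, sub_sub_cancel]
  · exact (lt_irrefl _ h3).elim

/-- Converse of the exponential limit `(1 + g n / n) ^ n → exp (lim g)`. -/
theorem tendsto_mul_one_sub_of_tendsto_pow {f : ℕ → ℝ} {c : ℝ} (hf : ∀ n, 0 ≤ f n)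
    (h : Tendsto (fun n => f n ^ n) atTop (𝓝 (Real.exp (-c)))) :
    Tendsto (fun n : ℕ => n * (1 - f n)) atTop (𝓝 c) := by
  have hlog : Tendsto (fun n : ℕ => n * -Real.log (f n)) atTop (𝓝 c) := by
    have := (h.log (Real.exp_ne_zero _)).neg
    rw [Real.log_exp, neg_neg] at this
    refine this.congr fun n => ?_
    rw [Real.log_pow, mul_neg]
  have hpos : ∀ᶠ n in atTop, 0 < f n := by
    filter_upwards [h.eventually (lt_mem_nhds (Real.exp_pos _)), eventually_ne_atTop 0] with n h1 h2
    refine (hf n).lt_of_ne fun h3 => ?_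
    rw [← h3, zero_pow h2] at h1
    exact lt_irrefl _ h1
  have hlog0 : Tendsto (fun n => Real.log (f n)) atTop (𝓝 0) := by
    have := (hlog.div_atTop tendsto_natCast_atTop_atTop).neg
    rw [neg_zero] at this
    refine this.congr' ?_
    filter_upwards [eventually_ne_atTop 0] with n hn
    have hn' : (n : ℝ) ≠ 0 := Nat.cast_ne_zero.2 hn
    field_simp
  have hone : Tendsto f atTop (𝓝 1) := by
    have := (Real.continuous_exp.tendsto 0).comp hlog0
    rw [Real.exp_zero] at this
    refine this.congr' ?_
    filter_upwards [hpos] with n hn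
    exact Real.exp_log hn
  have hlow := hone.mul hlog
  rw [one_mul] at hlow
  refine tendsto_of_tendsto_of_tendsto_of_le_of_le' hlow hlog ?_ ?_
  · filter_upwards [hpos] with n hn
    have h1 := Real.one_sub_inv_le_log_of_pos hn
    have h2 : f n * -Real.log (f n) ≤ 1 - f n := by
      have := mul_le_mul_of_nonneg_left h1 hn.le
      rw [mul_sub, mul_inv_cancel₀ hn.ne'] at this
      linarith
    calc f n * (n * -Real.log (f n)) = n * (f n * -Real.log (f n)) := by ring
      _ ≤ n * (1 - f n) := mul_le_mul_of_nonneg_left h2 (Nat.cast_nonneg _)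
  · filter_upwards [hpos] with n hn
    have h1 := Real.log_le_sub_one_of_pos hn
    exact mul_le_mul_of_nonneg_left (by linarith) (Nat.cast_nonneg _)

theorem InClassicalMaxDomain.regularlyVaryingAtTop_tail {α : ℝ} (hα : 0 < α) {F : ℝ → ℝ}
    (hF : IsDistributionFunction F) (h : InClassicalMaxDomain F (frechetDF α)) :
    RegularlyVaryingAtTop (tail F) (-α) := by
  obtain ⟨a, b, ha, hw⟩ := h
  refine HasParetoTailLimit.regularlyVaryingAtTop_tail hα hF (b := b) (fun x hx => ?_) ha
  have hx0 : 0 < x := one_pos.trans hx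
  have hcont : ContinuousAt (frechetDF α) x := by
    have h1 : ContinuousAt (fun z : ℝ => Real.exp (-z ^ (-α))) x :=
      (Real.continuousAt_rpow_const _ _ (Or.inl hx0.ne')).neg.rexp
    refine h1.congr ?_
    filter_upwards [lt_mem_nhds hx0] with z hz
    simp [frechetDF, hz]
  have hlim := hw x hcont
  simp only [frechetDF, hx0, if_true] at hlim
  exact tendsto_mul_one_sub_of_tendsto_pow (fun n => hF.nonneg _) hlim

/-! ### Normalization by the tail quantiles -/

section Quantile

variable {α : ℝ} {F : ℝ → ℝ}

theorem IsDistributionFunction.nonempty_tail_lt (hF : IsDistributionFunction F) {c : ℝ}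
    (hc : 0 < c) : {t : ℝ | tail F t < c}.Nonempty :=
  (hF.tendsto_tail_atTop.eventually (gt_mem_nhds hc)).exists

theorem IsDistributionFunction.tail_lt_of_tailQuantile_lt (hF : IsDistributionFunction F) {n : ℕ}
    (hn : n ≠ 0) {t : ℝ} (ht : tailQuantile F n < t) : tail F t < 1 / n := by
  have hn' : (0 : ℝ) < 1 / n := by positivity
  obtain ⟨s, hs, hst⟩ := exists_lt_of_csInf_lt (hF.nonempty_tail_lt hn') ht
  exact (hF.antitone_tail hst.le).trans_lt hs

/-- If the tail is positive everywhere, the quantiles tend to infinity, and the sets whose infimum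
they are become bounded below, so that `sInf` is a true infimum. -/
theorem IsDistributionFunction.tendsto_tailQuantile (hF : IsDistributionFunction F)
    (hpos : ∀ t, 0 < tail F t) :
    Tendsto (tailQuantile F) atTop atTop ∧
      ∀ᶠ n : ℕ in atTop, ∀ t < tailQuantile F n, 1 / (n : ℝ) ≤ tail F t := by
  have hlb : ∀ M, ∀ᶠ n : ℕ in atTop, M ∈ lowerBounds {t : ℝ | tail F t < 1 / (n : ℝ)} := by
    intro M
    have h0 : Tendsto (fun n : ℕ => 1 / (n : ℝ)) atTop (𝓝 0) :=
      tendsto_const_div_atTop_nhds_zero_nat 1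
    filter_upwards [h0.eventually (gt_mem_nhds (hpos M))] with n hn t ht
    exact (hF.antitone_tail.reflect_lt (lt_trans ht hn)).le
  refine ⟨tendsto_atTop.2 fun M => ?_, ?_⟩
  · filter_upwards [hlb M, eventually_ne_atTop 0] with n h1 h2
    exact le_csInf (hF.nonempty_tail_lt (by positivity)) h1
  · filter_upwards [hlb 0] with n h1 t ht
    by_contra h2
    exact not_lt_of_ge (csInf_le ⟨0, h1⟩ (not_le.1 h2)) ht

namespace RegularlyVaryingAtTop

theorem tail_pos (h : RegularlyVaryingAtTop (tail F) (-α)) (hF : IsDistributionFunction F)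
    (t : ℝ) : 0 < tail F t := by
  obtain ⟨s, hs, hts⟩ := (h.2.1.and (eventually_ge_atTop t)).exists
  exact hs.trans_le (hF.antitone_tail hts)

theorem eventually_tailQuantile_pos (h : RegularlyVaryingAtTop (tail F) (-α))
    (hF : IsDistributionFunction F) : ∀ᶠ n in atTop, 0 < tailQuantile F n :=
  (hF.tendsto_tailQuantile (h.tail_pos hF)).1.eventually_gt_atTop 0

/-- By regular variation, a possible jump of `F` at its quantile is asymptotically negligible. -/
theorem tendsto_mul_tail_tailQuantile (h : RegularlyVaryingAtTop (tail F) (-α))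
    (hF : IsDistributionFunction F) :
    Tendsto (fun n : ℕ => n * tail F (tailQuantile F n)) atTop (𝓝 1) := by
  have hpos := h.tail_pos hF
  obtain ⟨hu, hle⟩ := hF.tendsto_tailQuantile hpos
  have hu0 := h.eventually_tailQuantile_pos hF
  have hratio : ∀ y : ℝ, 0 < y → Tendsto
      (fun n => tail F (tailQuantile F n) / tail F (tailQuantile F n * y)) atTop
      (𝓝 (y ^ (-α))⁻¹) := fun y hy => by
    refine (((h.2.2 y hy).comp hu).inv₀ (Real.rpow_pos_of_pos hy _).ne').congr fun n => ?_
    simp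
  have hcont : Tendsto (fun y : ℝ => (y ^ (-α))⁻¹) (𝓝 1) (𝓝 1) := by
    have h1 : ContinuousAt (fun y : ℝ => (y ^ (-α))⁻¹) 1 :=
      (Real.continuousAt_rpow_const _ _ (Or.inl one_ne_zero)).inv₀ (by simp)
    simpa [ContinuousAt] using h1
  refine tendsto_order.2 ⟨fun c hc => ?_, fun c hc => ?_⟩
  · obtain ⟨y, hyc, hy0, hy1⟩ := (((hcont.mono_left nhdsWithin_le_nhds).eventually
      (lt_mem_nhds hc)).and (Ioo_mem_nhdsLT one_pos)).exists
    filter_upwards [(hratio y hy0).eventually (lt_mem_nhds hyc), hle, hu0,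
      eventually_gt_atTop 0] with n h1 h2 h3 h4
    have hn : (0 : ℝ) < n := Nat.cast_pos.2 h4
    have h5 := h2 _ (mul_lt_of_lt_one_right h3 hy1)
    refine h1.trans_le ?_
    rw [div_le_iff₀ (hpos _)]
    rw [div_le_iff₀ hn] at h5
    nlinarith [hpos (tailQuantile F n)]
  · obtain ⟨y, hyc, hy1⟩ := (((hcont.mono_left nhdsWithin_le_nhds).eventually
      (gt_mem_nhds hc)).and (self_mem_nhdsWithin (s := Set.Ioi 1))).exists
    filter_upwards [(hratio y (one_pos.trans hy1)).eventually (gt_mem_nhds hyc), hu0,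
      eventually_gt_atTop 0] with n h1 h3 h4
    have hn : (0 : ℝ) < n := Nat.cast_pos.2 h4
    have h5 := hF.tail_lt_of_tailQuantile_lt h4.ne' (lt_mul_of_one_lt_right h3 hy1)
    refine lt_of_le_of_lt ?_ h1
    rw [le_div_iff₀ (hpos _)]
    rw [lt_div_iff₀ hn] at h5
    nlinarith [hpos (tailQuantile F n)]

theorem tendsto_mul_tail (h : RegularlyVaryingAtTop (tail F) (-α))
    (hF : IsDistributionFunction F) {x : ℝ} (hx : 0 < x) :
    Tendsto (fun n : ℕ => n * tail F (tailQuantile F n * x)) atTop (𝓝 (x ^ (-α))) := by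
  have hpos := h.tail_pos hF
  have h1 := (h.tendsto_mul_tail_tailQuantile hF).mul
    ((h.2.2 x hx).comp (hF.tendsto_tailQuantile hpos).1)
  rw [one_mul] at h1
  refine h1.congr fun n => ?_
  have := (hpos (tailQuantile F n)).ne'
  simp only [Function.comp]
  field_simp

theorem weakConv_freeMaxPow (h : RegularlyVaryingAtTop (tail F) (-α))
    (hF : IsDistributionFunction F) :
    WeakConv (fun n x => freeMaxPow F n (tailQuantile F n * x + 0)) (paretoDF α) := by
  intro x _
  simp only [add_zero, hF.freeMaxPow_eq]
  by_cases hx : 0 < x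
  · simp only [paretoDF, hx, if_true]
    exact ((h.tendsto_mul_tail hF hx).const_sub 1).max tendsto_const_nhds
  · simp only [paretoDF, hx, if_false]
    have h1 := ((h.tendsto_mul_tail_tailQuantile hF).const_sub 1).max
      (tendsto_const_nhds (x := (0 : ℝ)))
    rw [sub_self, max_self] at h1
    refine tendsto_of_tendsto_of_tendsto_of_le_of_le' tendsto_const_nhds h1
      (.of_forall fun n => le_max_right _ _) ?_
    filter_upwards [h.eventually_tailQuantile_pos hF] with n hn
    refine max_le_max_right _ (sub_le_sub_left (mul_le_mul_of_nonneg_left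
      (hF.antitone_tail ?_) (Nat.cast_nonneg _)) _)
    nlinarith

theorem weakConv_pow (hα : 0 < α) (h : RegularlyVaryingAtTop (tail F) (-α))
    (hF : IsDistributionFunction F) :
    WeakConv (fun n x => F (tailQuantile F n * x + 0) ^ n) (frechetDF α) := by
  intro x _
  simp only [add_zero]
  have hlim : ∀ y : ℝ, 0 < y →
      Tendsto (fun n => F (tailQuantile F n * y) ^ n) atTop (𝓝 (Real.exp (-y ^ (-α)))) := by
    intro y hy
    have h1 : Tendsto (fun n : ℕ => n * -tail F (tailQuantile F n * y)) atTop
        (𝓝 (-y ^ (-α))) :=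
      (h.tendsto_mul_tail hF hy).neg.congr fun n => (mul_neg _ _).symm
    refine (Real.tendsto_one_add_pow_exp_of_tendsto h1).congr fun n => ?_
    simp [tail]
  by_cases hx : 0 < x
  · simp only [frechetDF, hx, if_true]
    exact hlim x hx
  · simp only [frechetDF, hx, if_false]
    refine tendsto_order.2 ⟨fun c hc => .of_forall fun n =>
      hc.trans_le (pow_nonneg (hF.nonneg _) n), fun c hc => ?_⟩
    have hzero : Tendsto (fun y : ℝ => Real.exp (-y ^ (-α))) (𝓝[>] 0) (𝓝 0) :=
      Real.tendsto_exp_neg_atTop_nhds_zero.comp (tendsto_rpow_neg_nhdsGT_zero (neg_lt_zero.2 hα))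
    obtain ⟨y, hyc, hy⟩ := ((hzero.eventually (gt_mem_nhds hc)).and
      (self_mem_nhdsWithin (s := Set.Ioi 0))).exists
    filter_upwards [(hlim y hy).eventually (gt_mem_nhds hyc), h.eventually_tailQuantile_pos hF]
      with n h1 h2
    refine (pow_le_pow_left₀ (hF.nonneg _) (hF.monotone ?_) n).trans_lt h1
    nlinarith

end RegularlyVaryingAtTop

end Quantile

/-- Finitely many values of a norming sequence can be changed, so its positivity is only needed
eventually. -/
theorem exists_pos_of_eventually_pos {u : ℕ → ℝ} (hu : ∀ᶠ n in atTop, 0 < u n)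
    {G : ℝ → ℝ} {H : ℕ → ℝ → ℝ} (hw : WeakConv (fun n x => H n (u n * x + 0)) G) :
    ∃ a b : ℕ → ℝ, (∀ n, 0 < a n) ∧ WeakConv (fun n x => H n (a n * x + b n)) G := by
  refine ⟨fun n => if 0 < u n then u n else 1, fun _ => 0, fun n => ?_, fun x hx => ?_⟩
  · dsimp only
    split_ifs with h
    exacts [h, one_pos]
  · refine (hw x hx).congr' ?_
    filter_upwards [hu] with n hn
    simp [hn]

theorem theorem6p12 (α : ℝ) (hα : 0 < α) (F : ℝ → ℝ) (hF : IsDistributionFunction F) :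
    List.TFAE [
      InFreeMaxDomain F (paretoDF α),
      InClassicalMaxDomain F (frechetDF α),
      RegularlyVaryingAtTop (tail F) (-α)] ∧
    (InFreeMaxDomain F (paretoDF α) →
      (∀ᶠ n in atTop, 0 < tailQuantile F n) ∧
      WeakConv (fun n x => freeMaxPow F n (tailQuantile F n * x + 0)) (paretoDF α)) ∧
    (InClassicalMaxDomain F (frechetDF α) →
      (∀ᶠ n in atTop, 0 < tailQuantile F n) ∧
      WeakConv (fun n x => F (tailQuantile F n * x + 0) ^ n) (frechetDF α)) := by
  refine ⟨?_, fun h => ?_, fun h => ?_⟩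
  · tfae_have 1 → 3 := InFreeMaxDomain.regularlyVaryingAtTop_tail hα hF
    tfae_have 2 → 3 := InClassicalMaxDomain.regularlyVaryingAtTop_tail hα hF
    tfae_have 3 → 1 := fun h =>
      exists_pos_of_eventually_pos (h.eventually_tailQuantile_pos hF) (h.weakConv_freeMaxPow hF)
    tfae_have 3 → 2 := fun h =>
      exists_pos_of_eventually_pos (H := fun n x => F x ^ n) (h.eventually_tailQuantile_pos hF)
        (h.weakConv_pow hα hF)
    tfae_finish
  · have h' := InFreeMaxDomain.regularlyVaryingAtTop_tail hα hF h
    exact ⟨h'.eventually_tailQuantile_pos hF, h'.weakConv_freeMaxPow hF⟩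
  · have h' := InClassicalMaxDomain.regularlyVaryingAtTop_tail hα hF h
    exact ⟨h'.eventually_tailQuantile_pos hF, h'.weakConv_pow hα hF⟩
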